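/- Let $2 \le m \le n$ be integers and let $\mathcal{O}$ be a field or a discrete valuation ring. Let $P = \mathcal{O}[X]$ be the polynomial ring in the $mn$ entries of the generic $m \times n$ matrix $X$. For $1 \le i \le n-m+1$ let $f_i = \det X_{[i,\,i+m-1]}$ be the maximal minor of $X$ on the consecutive columns $i, i+1, \dots, i+m-1$, and set $J = (f_1, \dots, f_{n-m+1})$ and $C = P/J$. Then: 1. $f_1, \dots, f_{n-m+1}$ is a regular sequence in $P$; 2. $C$ is a complete intersection, that is, isomorphic to the quotient of a regular Noetherian ring by an ideal generated by a regular sequence; 3. the Krull dimension of $C$ is $mn - n + m - 1$ if $\mathcal{O}$ is a field, and $mn - n + m$ if $\mathcal{O}$ is a discrete valuation ring; 4. $C$ is reduced. -/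

import Mathlib

universe u

namespace ConsecutiveMinors

/-- A (global) complete intersection: a ring isomorphic to the quotient of a regular
Noetherian ring by the ideal generated by a regular sequence. -/
def IsCompleteIntersection (R : Type u) [CommRing R] : Prop :=
  ∃ (S : Type u) (_ : CommRing S) (rs : List S),
    IsRegularRing S ∧ RingTheory.Sequence.IsRegular S rs ∧
      Nonempty (R ≃+* S ⧸ Ideal.ofList rs)

/-- The polynomial ring `𝒪[X]` in the entries of the generic `m × n` matrix
`X = Matrix.mvPolynomialX (Fin m) (Fin n) 𝒪`. -/
abbrev P (𝒪 : Type u) [CommRing 𝒪] (m n : ℕ) : Type u :=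
  MvPolynomial (Fin m × Fin n) 𝒪

/-- The maximal minor of the generic `m × n` matrix on the `m` consecutive columns
`i, i + 1, …, i + m - 1` (rows, columns and `i` are numbered from `0`). -/
noncomputable def f (𝒪 : Type u) [CommRing 𝒪] (m n : ℕ) (i : Fin (n - (m - 1))) : P 𝒪 m n :=
  ((Matrix.mvPolynomialX (Fin m) (Fin n) 𝒪).submatrix id
    (fun j : Fin m => (⟨(i : ℕ) + (j : ℕ), by omega⟩ : Fin n))).det

/-- The ideal generated by the consecutive maximal minors. -/
noncomputable def J (𝒪 : Type u) [CommRing 𝒪] (m n : ℕ) : Ideal (P 𝒪 m n) :=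
  Ideal.span (Set.range (f 𝒪 m n))

/-- The quotient of the polynomial ring by the consecutive maximal minors. -/
abbrev C (𝒪 : Type u) [CommRing 𝒪] (m n : ℕ) : Type u :=
  P 𝒪 m n ⧸ J 𝒪 m n

end ConsecutiveMinors

open MvPolynomial
open scoped MonomialOrder nonZeroDivisors

/-! ### Monic polynomials with pairwise coprime leading monomials. -/

namespace MonomialOrder

section Groebner

/-! In the lexicographic order that reads the matrix column by column, the leading term of each
minor is its main diagonal, with coefficient 1. Distinct consecutive minors have disjoint diagonals,
so the leading monomials are squarefree and pairwise coprime. Coprimality makes the minors a Gröbner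
basis (`exists_degree_le_of_mem_span`), hence a regular sequence over any domain (`isRegular_ofFn`);
squarefreeness makes the ideal radical (`isRadical_span_range`). Regularity bounds the dimension
from above. Krull's height theorem, applied at the origin over a maximal ideal of the base of full
height, bounds it from below (`ringKrullDim_C_add`). -/

theorem _root_.Finsupp.le_of_le_add_of_disjoint {σ : Type*} {a b c : σ →₀ ℕ} (hab : Disjoint a b) (h : a ≤ c + b) :
    a ≤ c := by
  intro x
  have h1 := h x
  have h2 : min (a x) (b x) = 0 := by
    have := DFunLike.congr_fun hab.eq_bot x
    simpa only [Finsupp.inf_apply, _root_.bot_eq_zero, Finsupp.coe_zero, Pi.zero_apply] using this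
  simp only [Finsupp.add_apply] at h1
  omega

variable {σ ι R : Type*} [CommRing R] {ord : MonomialOrder σ}
  {g : ι → MvPolynomial σ R}

/-- Division by a family of monic polynomials: every polynomial is congruent to one whose
degree is not divisible by the degree of any of them. -/
theorem exists_sub_mem_span_not_degree_le (hg : ∀ i, ord.Monic (g i)) (s : Set ι)
    (h : MvPolynomial σ R) :
    ∃ r, h - r ∈ Ideal.span (g '' s) ∧
      (r ≠ 0 → ∀ i ∈ s, ¬ ord.degree (g i) ≤ ord.degree r) := by
  obtain ⟨q, r, hqr, -, hr⟩ := ord.div_set (B := g '' s)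
    (by rintro _ ⟨i, -, rfl⟩; simp [(hg i).leadingCoeff_eq_one]) h
  refine ⟨r, ?_, fun h0 i hi => hr _ (degree_mem_support h0) _ ⟨i, hi, rfl⟩⟩
  rw [hqr, add_sub_cancel_right, Finsupp.linearCombination_apply]
  exact Submodule.sum_mem _ fun b _ =>
    Submodule.smul_mem _ _ (Ideal.subset_span b.2)

variable [IsDomain R]

/-- Monic polynomials with pairwise coprime leading monomials form a Gröbner basis. -/
theorem exists_degree_le_of_mem_span (hg : ∀ i, ord.Monic (g i))
    (hd : Pairwise fun i j => Disjoint (ord.degree (g i)) (ord.degree (g j)))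
    (s : Finset ι) {h : MvPolynomial σ R} (hh : h ∈ Ideal.span (g '' s)) (h0 : h ≠ 0) :
    ∃ i ∈ s, ord.degree (g i) ≤ ord.degree h := by
  classical
  induction s using Finset.induction_on generalizing h with
  | empty => simp_all
  | insert a s ha ih =>
    rw [Finset.coe_insert, Set.image_insert_eq, Ideal.span_insert, Submodule.mem_sup] at hh
    obtain ⟨y, hy, z, hz, rfl⟩ := hh
    obtain ⟨b, rfl⟩ := Ideal.mem_span_singleton'.1 hy
    obtain ⟨r, hbr, hr⟩ := exists_sub_mem_span_not_degree_le hg (s : Set ι) b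
    obtain ⟨w, hw⟩ : ∃ w, w = (b - r) * g a + z := ⟨_, rfl⟩
    have hwm : w ∈ Ideal.span (g '' (s : Set ι)) :=
      hw ▸ add_mem (Ideal.mul_mem_right _ _ hbr) hz
    have heq : b * g a + z = r * g a + w := by rw [hw]; ring
    rw [heq] at h0 ⊢
    by_cases hr0 : r = 0
    · subst hr0
      simp only [zero_mul, zero_add] at h0 ⊢
      obtain ⟨i, hi, hle⟩ := ih hwm h0
      exact ⟨i, Finset.mem_insert_of_mem hi, hle⟩
    have hdeg : ord.degree (r * g a) = ord.degree r + ord.degree (g a) :=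
      degree_mul hr0 (hg a).ne_zero
    by_cases hw0 : w = 0
    · exact ⟨a, Finset.mem_insert_self _ _, by simp [hw0, hdeg]⟩
    obtain ⟨i, hi, hle⟩ := ih hwm hw0
    have hia : i ≠ a := fun h => ha (h ▸ hi)
    rcases lt_trichotomy (ord.toSyn (ord.degree (r * g a))) (ord.toSyn (ord.degree w))
      with hlt | he | hlt
    · exact ⟨i, Finset.mem_insert_of_mem hi, by rwa [degree_add_eq_right_of_lt hlt]⟩
    · rw [← ord.toSyn.injective he, hdeg] at hle
      exact absurd (Finsupp.le_of_le_add_of_disjoint (hd hia) hle) (hr hr0 i hi)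
    · exact ⟨a, Finset.mem_insert_self _ _, by
        rw [degree_add_of_lt hlt, hdeg]; exact le_add_self⟩

theorem mem_span_of_mul_mem_span (hg : ∀ i, ord.Monic (g i))
    (hd : Pairwise fun i j => Disjoint (ord.degree (g i)) (ord.degree (g j)))
    (s : Finset ι) {a : ι} (ha : a ∉ s) {h : MvPolynomial σ R}
    (hh : h * g a ∈ Ideal.span (g '' s)) : h ∈ Ideal.span (g '' s) := by
  obtain ⟨r, hhr, hr⟩ := exists_sub_mem_span_not_degree_le hg (s : Set ι) h
  suffices r = 0 by simpa [this] using hhr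
  by_contra hr0
  have hmem : r * g a ∈ Ideal.span (g '' (s : Set ι)) := by
    have := sub_mem hh (Ideal.mul_mem_right (g a) _ hhr)
    convert this using 1; ring
  obtain ⟨i, hi, hle⟩ := exists_degree_le_of_mem_span hg hd s hmem
    (mul_ne_zero hr0 (hg a).ne_zero)
  rw [degree_mul hr0 (hg a).ne_zero] at hle
  exact hr hr0 i hi (Finsupp.le_of_le_add_of_disjoint (hd (ne_of_mem_of_not_mem hi ha)) hle)

/-- A squarefree monomial dividing a power of a monomial divides that monomial, so a nonzero
remainder cannot be nilpotent modulo the ideal. -/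
theorem isRadical_span_range [Fintype ι] (hg : ∀ i, ord.Monic (g i))
    (hd : Pairwise fun i j => Disjoint (ord.degree (g i)) (ord.degree (g j)))
    (hsq : ∀ i x, ord.degree (g i) x ≤ 1) : (Ideal.span (Set.range g)).IsRadical := by
  rintro h ⟨N, hN⟩
  have hrange : g '' ((Finset.univ : Finset ι) : Set ι) = Set.range g := by simp
  rw [← hrange] at hN ⊢
  obtain ⟨r, hhr, hr⟩ := exists_sub_mem_span_not_degree_le hg
    ((Finset.univ : Finset ι) : Set ι) h
  suffices r = 0 by simpa [this] using hhr
  by_contra hr0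
  have hmem : r ^ N ∈ Ideal.span (g '' ((Finset.univ : Finset ι) : Set ι)) := by
    have := sub_mem hN (Ideal.mem_of_dvd _ (sub_dvd_pow_sub_pow h r N) hhr)
    simpa using this
  obtain ⟨i, hi, hle⟩ := exists_degree_le_of_mem_span hg hd _ hmem (pow_ne_zero _ hr0)
  rw [degree_pow] at hle
  refine hr hr0 i hi fun x => ?_
  have h1 := hle x
  have h2 := hsq i x
  simp only [Finsupp.smul_apply, smul_eq_mul] at h1
  rcases Nat.eq_zero_or_pos (ord.degree r x) with h3 | h3
  · simpa [h3] using h1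
  · omega

theorem span_ne_top (hg : ∀ i, ord.Monic (g i))
    (hd : Pairwise fun i j => Disjoint (ord.degree (g i)) (ord.degree (g j)))
    (h0 : ∀ i, ord.degree (g i) ≠ 0) (s : Finset ι) : Ideal.span (g '' s) ≠ ⊤ := by
  intro htop
  obtain ⟨i, -, hle⟩ := exists_degree_le_of_mem_span hg hd s
    ((Ideal.eq_top_iff_one _).1 htop) one_ne_zero
  rw [degree_one] at hle
  exact h0 i (le_antisymm hle bot_le)

/-- Each new generator is a nonzerodivisor modulo the previous ones, so the dimension drops by at
least one. -/
theorem ringKrullDim_quotient_span_add_card_le (hg : ∀ i, ord.Monic (g i))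
    (hd : Pairwise fun i j => Disjoint (ord.degree (g i)) (ord.degree (g j)))
    (s : Finset ι) :
    ringKrullDim (MvPolynomial σ R ⧸ Ideal.span (g '' s)) + s.card ≤
      ringKrullDim (MvPolynomial σ R) := by
  classical
  induction s using Finset.induction_on with
  | empty =>
    rw [Finset.card_empty, Nat.cast_zero, add_zero]
    exact ringKrullDim_quotient_le _
  | insert a s ha ih =>
    refine le_trans ?_ ih
    rw [Finset.card_insert_of_notMem ha, Nat.cast_add, Nat.cast_one, add_comm (s.card : WithBot ℕ∞),
      ← add_assoc]
    gcongr
    have hle : Ideal.span (g '' (s : Set ι)) ≤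
        Ideal.span (g '' ((insert a s : Finset ι) : Set ι)) :=
      Ideal.span_mono (Set.image_mono (by simp))
    refine ringKrullDim_succ_le_of_surjective (Ideal.Quotient.factor hle)
      (Ideal.Quotient.factor_surjective hle) (r := Ideal.Quotient.mk _ (g a)) ?_ ?_
    · rw [mem_nonZeroDivisors_iff_right]
      intro z hz
      obtain ⟨z, rfl⟩ := Ideal.Quotient.mk_surjective z
      rw [← map_mul, Ideal.Quotient.eq_zero_iff_mem] at hz
      exact Ideal.Quotient.eq_zero_iff_mem.2 (mem_span_of_mul_mem_span hg hd s ha hz)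
    · rw [Ideal.Quotient.factor_mk, Ideal.Quotient.eq_zero_iff_mem]
      exact Ideal.subset_span ⟨a, by simp, rfl⟩

theorem isRegular_ofFn {r : ℕ} {g : Fin r → MvPolynomial σ R} (hg : ∀ i, ord.Monic (g i))
    (hd : Pairwise fun i j => Disjoint (ord.degree (g i)) (ord.degree (g j)))
    (h0 : ∀ i, ord.degree (g i) ≠ 0) :
    RingTheory.Sequence.IsRegular (MvPolynomial σ R) (List.ofFn g) := by
  refine ⟨(RingTheory.Sequence.isWeaklyRegular_iff _ _).2 fun i hi => ?_, ?_⟩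
  · have hir : i < r := by simpa using hi
    have hI : Ideal.ofList ((List.ofFn g).take i) =
        Ideal.span (g '' ((Finset.univ.filter fun j : Fin r => (j : ℕ) < i : Finset _) : Set _)) := by
      refine congrArg Ideal.span (Set.ext fun x => ?_)
      simp only [List.mem_take_iff_getElem, Set.mem_ofPred_eq, Set.mem_image]
      constructor
      · rintro ⟨j, hj, rfl⟩
        have : j < i ∧ j < r := by simpa using hj
        exact ⟨⟨j, this.2⟩, by simpa using this.1, by simp⟩
      · rintro ⟨j, hj, rfl⟩
        have hj' : (j : ℕ) < i := by simpa using hj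
        exact ⟨j, by simp [hj'], by simp⟩
    rw [isSMulRegular_iff_right_eq_zero_of_smul]
    intro z hz
    obtain ⟨z, rfl⟩ := Submodule.Quotient.mk_surjective _ z
    rw [← Submodule.Quotient.mk_smul, Submodule.Quotient.mk_eq_zero, smul_eq_mul, Ideal.mul_top,
      hI, smul_eq_mul, mul_comm] at hz
    rw [Submodule.Quotient.mk_eq_zero, smul_eq_mul, Ideal.mul_top, hI]
    refine mem_span_of_mul_mem_span hg hd _ (a := ⟨i, hir⟩) (by simp) ?_
    simpa using hz
  · have := span_ne_top hg hd h0 Finset.univ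
    rw [smul_eq_mul, Ideal.mul_top]
    intro h
    refine this ?_
    rw [h]
    refine congrArg Ideal.span (Set.ext fun x => ?_)
    simp [List.mem_ofFn]

end Groebner

end MonomialOrder

/-! ### Height of the origin over a maximal ideal of the base. -/

namespace MvPolynomial

theorem height_comap_constantCoeff {R : Type*} [CommRing R] [IsNoetherianRing R] (𝔪 : Ideal R)
    [𝔪.IsMaximal] (ι : Type*) [Finite ι] :
    (𝔪.comap (constantCoeff (σ := ι) (R := R))).height = 𝔪.height + Nat.card ι := by
  induction ι using Finite.induction_empty_option with
  | of_equiv e ih =>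
    rw [← Nat.card_congr e, ← ih, ← RingEquiv.height_comap (renameEquiv R e).toRingEquiv]
    congr 1
    ext p
    simp
  | h_empty =>
    rw [← RingEquiv.height_comap (isEmptyRingEquiv R PEmpty).symm]
    simp only [Nat.card_of_isEmpty, Nat.cast_zero, add_zero]
    congr 1
    ext p
    change constantCoeff ((isEmptyRingEquiv R PEmpty).symm p) ∈ 𝔪 ↔ _
    simp
  | @h_option ι _ ih =>
    let e := (optionEquivLeft R ι).toRingEquiv
    let p := 𝔪.comap (constantCoeff (σ := ι) (R := R))
    let P : Ideal (Polynomial (MvPolynomial ι R)) := p.comap Polynomial.constantCoeff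
    have hp : p.IsMaximal := Ideal.comap_isMaximal_of_surjective _ fun r => ⟨C r, by simp⟩
    have hP : P.IsMaximal := Ideal.comap_isMaximal_of_surjective _ fun r =>
      ⟨Polynomial.C r, by simp⟩
    have : P.LiesOver p := ⟨by ext x; simp [P, Ideal.under]⟩
    have h1 : 𝔪.comap (constantCoeff (σ := Option ι) (R := R)) = P.comap e := by
      have : (constantCoeff (σ := Option ι) (R := R)) =
          ((constantCoeff (σ := ι) (R := R)).comp Polynomial.constantCoeff).comp
            (e : MvPolynomial (Option ι) R →+* _) := by
        ext x
        · simp [e]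
        · cases x <;> simp [e]
      rw [this]
      rfl
    rw [h1, RingEquiv.height_comap, Polynomial.height_eq_height_add_one p P, ih]
    simp [add_assoc]

end MvPolynomial

/-! ### Leading terms of the consecutive minors. -/

namespace ConsecutiveMinors

/-- Positions in a matrix, ordered column by column. -/
abbrev columnOrder (m n : ℕ) : LinearOrder (Fin m × Fin n) :=
  LinearOrder.lift' (fun p => toLex p.swap) fun _ _ h => Prod.swap_injective (toLex.injective h)

/-- The lexicographic monomial order in which the variables decrease down each column and
from each column to the next. -/
noncomputable def columnLex (m n : ℕ) : MonomialOrder (Fin m × Fin n) :=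
  @MonomialOrder.lex (Fin m × Fin n) (columnOrder m n)
    (@Finite.to_wellFoundedGT _ _ (columnOrder m n).toPreorder)

theorem columnLex_lt_of {m n : ℕ} {c d : Fin m × Fin n →₀ ℕ} (p : Fin m × Fin n)
    (heq : ∀ q : Fin m × Fin n, q.2 < p.2 ∨ q.2 = p.2 ∧ q.1 < p.1 → c q = d q) (hlt : c p < d p) :
    c ≺[columnLex m n] d :=
  ⟨p, fun q hq => heq q (Prod.Lex.lt_iff.1 hq), hlt⟩

variable {m n : ℕ}

/-- The exponent of the monomial belonging to the permutation `τ` in the minor on the columns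
`i, …, i + m - 1`. -/
noncomputable def minorExponent (i : Fin (n - (m - 1))) (τ : Equiv.Perm (Fin m)) :
    Fin m × Fin n →₀ ℕ :=
  ∑ j : Fin m, Finsupp.single (τ j, (⟨(i : ℕ) + (j : ℕ), by omega⟩ : Fin n)) 1

theorem minorExponent_apply (i : Fin (n - (m - 1))) (τ : Equiv.Perm (Fin m))
    (a : Fin m) (b : Fin n) :
    minorExponent i τ (a, b) = if (b : ℕ) = i + (τ.symm a : Fin m) then 1 else 0 := by
  classical
  rw [minorExponent, Finsupp.finsetSum_apply, Finset.sum_eq_single (τ.symm a)]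
  · simp [Finsupp.single_apply, Fin.ext_iff, eq_comm]
  · intro j _ hj
    rw [Finsupp.single_apply, if_neg]
    intro h
    exact hj ((Equiv.eq_symm_apply τ).2 (congrArg Prod.fst h))
  · simp

/-- At the first index `j` moved by `τ`, the diagonal contains the entry `(j, i + j)` and the
monomial of `τ` does not; at all earlier positions the two agree. -/
theorem minorExponent_lt (i : Fin (n - (m - 1))) {τ : Equiv.Perm (Fin m)} (hτ : τ ≠ 1) :
    minorExponent i τ ≺[columnLex m n] minorExponent i 1 := by
  obtain ⟨j, hj, hmin⟩ : ∃ j, τ j ≠ j ∧ ∀ k < j, τ k = k := by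
    have hex : ∃ j, τ j ≠ j := by
      by_contra! h
      exact hτ (Equiv.ext h)
    obtain ⟨j, hj, hmin⟩ := WellFounded.has_min (wellFounded_lt (α := Fin m)) {j | τ j ≠ j} hex
    exact ⟨j, hj, fun k hk => by_contra fun h => hmin k h hk⟩
  have hinv : ∀ k < j, τ.symm k = k := fun k hk => (Equiv.symm_apply_eq τ).2 (hmin k hk).symm
  have hjs : τ.symm j ≠ j := fun h => hj ((Equiv.symm_apply_eq τ).1 h).symm
  refine columnLex_lt_of (j, ⟨(i : ℕ) + j, by omega⟩) ?_ ?_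
  · rintro ⟨a, b⟩ h
    rw [minorExponent_apply, minorExponent_apply]
    rcases lt_or_ge a j with ha | ha
    · rw [hinv a ha]; rfl
    · have hb : (b : ℕ) < i + j := by
        rcases h with h | ⟨-, h⟩
        · exact h
        · exact absurd h (not_lt.2 ha)
      have h1 : (b : ℕ) ≠ i + a := by have : (j : ℕ) ≤ a := ha; omega
      have h2 : j ≤ τ.symm a := by
        by_contra! hlt
        have := hmin _ hlt
        rw [Equiv.apply_symm_apply] at this
        exact absurd hlt (not_lt.2 (this ▸ ha))
      have h3 : (b : ℕ) ≠ i + (τ.symm a : Fin m) := by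
        have : (j : ℕ) ≤ (τ.symm a : Fin m) := h2
        omega
      rw [if_neg h3, if_neg]
      exact h1
  · rw [minorExponent_apply, minorExponent_apply, if_neg, if_pos]
    · exact one_pos
    · rfl
    · intro h
      exact hjs (Fin.ext (Nat.add_left_cancel h).symm)

section Leading

variable {𝒪 : Type u} [CommRing 𝒪]

theorem f_eq_sum (i : Fin (n - (m - 1))) :
    f 𝒪 m n i = ∑ τ : Equiv.Perm (Fin m), Equiv.Perm.sign τ • monomial (minorExponent i τ) 1 := by
  rw [f, Matrix.det_apply]
  refine Finset.sum_congr rfl fun τ _ => ?_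
  congr 1
  simp only [Matrix.submatrix_apply, Matrix.mvPolynomialX_apply, id]
  rw [minorExponent, monomial_sum_one]
  rfl

theorem support_f_sub_subset (i : Fin (n - (m - 1))) {c : Fin m × Fin n →₀ ℕ}
    (hc : c ∈ (f 𝒪 m n i - monomial (minorExponent i 1) 1).support) :
    c ≺[columnLex m n] minorExponent i 1 := by
  classical
  rw [f_eq_sum, ← Finset.add_sum_erase _ _ (Finset.mem_univ 1), Equiv.Perm.sign_one, one_smul,
    add_sub_cancel_left] at hc
  obtain ⟨τ, hτ, hc⟩ := Finset.mem_biUnion.1 (support_sum hc)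
  have : c = minorExponent i τ := by
    by_contra hne
    rw [mem_support_iff, Units.smul_def, coeff_smul, coeff_monomial, if_neg (Ne.symm hne),
      smul_zero] at hc
    exact hc rfl
  rw [this]
  exact minorExponent_lt i (Finset.ne_of_mem_erase hτ)

theorem minorExponent_one_ne_zero (hm : 0 < m) (i : Fin (n - (m - 1))) :
    minorExponent i 1 ≠ 0 := by
  intro h
  have := DFunLike.congr_fun h (⟨0, hm⟩, ⟨i, by omega⟩)
  rw [minorExponent_apply] at this
  exact one_ne_zero ((if_pos (show (i : ℕ) = i + 0 from rfl)).symm.trans this)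

theorem degree_f_sub_lt [Nontrivial 𝒪] (hm : 0 < m) (i : Fin (n - (m - 1))) :
    (columnLex m n).degree (f 𝒪 m n i - monomial (minorExponent i 1) 1) ≺[columnLex m n]
      (columnLex m n).degree (monomial (minorExponent i 1) (1 : 𝒪)) := by
  classical
  rw [MonomialOrder.degree_monomial, if_neg one_ne_zero, MonomialOrder.degree_lt_iff]
  · exact fun c hc => support_f_sub_subset i hc
  · rw [map_zero, MonomialOrder.toSyn_lt_iff_ne_zero, Ne, MonomialOrder.toSyn_eq_zero_iff]
    exact minorExponent_one_ne_zero hm i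

theorem monic_f [Nontrivial 𝒪] (hm : 0 < m) (i : Fin (n - (m - 1))) :
    (columnLex m n).Monic (f 𝒪 m n i) := by
  rw [← add_sub_cancel (monomial (minorExponent i 1) 1) (f 𝒪 m n i)]
  exact MonomialOrder.monic_monomial_one.add_of_lt (degree_f_sub_lt hm i)

theorem degree_f [Nontrivial 𝒪] (hm : 0 < m) (i : Fin (n - (m - 1))) :
    (columnLex m n).degree (f 𝒪 m n i) = minorExponent i 1 := by
  classical
  rw [← add_sub_cancel (monomial (minorExponent i 1) 1) (f 𝒪 m n i),
    MonomialOrder.degree_add_of_lt (degree_f_sub_lt hm i), MonomialOrder.degree_monomial,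
    if_neg one_ne_zero]

theorem degree_f_ne_zero [Nontrivial 𝒪] (hm : 0 < m) (i : Fin (n - (m - 1))) :
    (columnLex m n).degree (f 𝒪 m n i) ≠ 0 :=
  degree_f (𝒪 := 𝒪) hm i ▸ minorExponent_one_ne_zero hm i

theorem degree_f_apply_le_one [Nontrivial 𝒪] (hm : 0 < m) (i : Fin (n - (m - 1)))
    (x : Fin m × Fin n) : (columnLex m n).degree (f 𝒪 m n i) x ≤ 1 := by
  obtain ⟨a, b⟩ := x
  rw [degree_f hm, minorExponent_apply]
  split_ifs <;> simp

/-- A position `(a, b)` on the diagonal of minor `i` satisfies `b = i + a`, which determines `i`. -/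
theorem pairwise_disjoint_degree_f [Nontrivial 𝒪] (hm : 0 < m) :
    Pairwise fun i j => Disjoint ((columnLex m n).degree (f 𝒪 m n i))
      ((columnLex m n).degree (f 𝒪 m n j)) := by
  intro i j hij
  rw [degree_f hm, degree_f hm, disjoint_iff]
  ext ⟨a, b⟩
  rw [Finsupp.inf_apply, minorExponent_apply, minorExponent_apply]
  have : (i : ℕ) ≠ j := fun h => hij (Fin.ext h)
  split_ifs <;> first | omega | rfl

/-! ### Regularity, reducedness and dimension of the quotient. -/

theorem isRegular_f [IsDomain 𝒪] (hm : 0 < m) :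
    RingTheory.Sequence.IsRegular (P 𝒪 m n) (List.ofFn (f 𝒪 m n)) :=
  MonomialOrder.isRegular_ofFn (monic_f hm) (pairwise_disjoint_degree_f hm) (degree_f_ne_zero hm)

theorem ofList_ofFn_f : Ideal.ofList (List.ofFn (f 𝒪 m n)) = J 𝒪 m n :=
  congrArg Ideal.span (Set.ext fun x => by simp [List.mem_ofFn])

theorem isCompleteIntersection_C [IsDomain 𝒪] [IsRegularRing 𝒪] (hm : 0 < m) :
    IsCompleteIntersection (C 𝒪 m n) :=
  ⟨P 𝒪 m n, inferInstance, List.ofFn (f 𝒪 m n), inferInstance, isRegular_f hm,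
    ⟨Ideal.quotEquivOfEq ofList_ofFn_f.symm⟩⟩

theorem isReduced_C [IsDomain 𝒪] (hm : 0 < m) : IsReduced (C 𝒪 m n) :=
  (Ideal.isRadical_iff_quotient_reduced _).1 <| MonomialOrder.isRadical_span_range (monic_f hm)
    (pairwise_disjoint_degree_f hm) (degree_f_apply_le_one hm)

theorem J_le_comap_constantCoeff [Nontrivial 𝒪] (hm : 0 < m) (𝔪 : Ideal 𝒪) :
    J 𝒪 m n ≤ 𝔪.comap (constantCoeff (σ := Fin m × Fin n)) := by
  rw [J, Ideal.span_le]
  rintro _ ⟨i, rfl⟩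
  have : constantCoeff (f 𝒪 m n i) = 0 := by
    rw [f_eq_sum, map_sum]
    refine Finset.sum_eq_zero fun τ _ => ?_
    rw [Units.smul_def, map_zsmul, constantCoeff_monomial, if_neg, smul_zero]
    intro h
    have := DFunLike.congr_fun h (τ ⟨0, hm⟩, ⟨i, by omega⟩)
    rw [minorExponent_apply] at this
    simp at this
  simp [this]

theorem ringKrullDim_C_add [IsDomain 𝒪] [IsNoetherianRing 𝒪] (hm : 0 < m) (𝔪 : Ideal 𝒪)
    [𝔪.IsMaximal] (h𝔪 : (𝔪.height : WithBot ℕ∞) = ringKrullDim 𝒪) :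
    ringKrullDim (C 𝒪 m n) + (n - (m - 1) : ℕ) = ringKrullDim 𝒪 + (m * n : ℕ) := by
  apply le_antisymm
  · have := MonomialOrder.ringKrullDim_quotient_span_add_card_le (monic_f (𝒪 := 𝒪) hm)
      (pairwise_disjoint_degree_f (m := m) (n := n) hm) Finset.univ
    rw [Finset.coe_univ, Set.image_univ, MvPolynomial.ringKrullDim_of_isNoetherianRing] at this
    simp only [Finset.card_univ, Fintype.card_fin, Nat.card_eq_fintype_card,
      Fintype.card_prod] at this
    exact this
  · have hp := Ideal.comap_isMaximal_of_surjective
      (constantCoeff (σ := Fin m × Fin n) (R := 𝒪)) (K := 𝔪) fun r => ⟨MvPolynomial.C r, by simp⟩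
    have h1 := height_le_ringKrullDim_quotient_add_spanFinrank (J_le_comap_constantCoeff
      (n := n) hm 𝔪)
    rw [height_comap_constantCoeff] at h1
    have h2 : (J 𝒪 m n).spanFinrank ≤ n - (m - 1) := by
      refine (Submodule.spanFinrank_span_le_ncard_of_finite (Set.finite_range _)).trans ?_
      rw [← Set.image_univ]
      refine (Set.ncard_image_le Set.finite_univ).trans ?_
      simp
    calc ringKrullDim 𝒪 + (m * n : ℕ) ≤ _ := by simpa [h𝔪] using h1
      _ ≤ _ := by gcongr

theorem ringKrullDim_C [IsDomain 𝒪] [IsNoetherianRing 𝒪] (hm : 0 < m) (hmn : m ≤ n) (𝔪 : Ideal 𝒪)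
    [𝔪.IsMaximal] {d : ℕ} (h𝔪 : 𝔪.height = d) (hd : ringKrullDim 𝒪 = d) :
    ringKrullDim (C 𝒪 m n) = ((m * n - n + (m - 1) + d : ℕ) : WithBot ℕ∞) := by
  have h := ringKrullDim_C_add (n := n) hm 𝔪 (by rw [h𝔪, hd]; rfl)
  have hle : n ≤ m * n := Nat.le_mul_of_pos_left n hm
  -- Both truncated subtractions are exact, since `n ≤ m * n` and `m ≤ n`.
  have hnat : d + m * n = (m * n - n + (m - 1) + d) + (n - (m - 1)) := by omega
  rw [hd, ← Nat.cast_add, hnat, Nat.cast_add] at h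
  generalize ringKrullDim (C 𝒪 m n) = x at h ⊢
  exact (ENat.WithBot.add_natCast_cancel).1 h

end Leading

end ConsecutiveMinors

theorem mainTheorem3 (m n : ℕ) (hm : 2 ≤ m) (hmn : m ≤ n) :
    (∀ (k : Type u) [Field k],
      RingTheory.Sequence.IsRegular (ConsecutiveMinors.P k m n)
        (List.ofFn (ConsecutiveMinors.f k m n)) ∧
      ConsecutiveMinors.IsCompleteIntersection (ConsecutiveMinors.C k m n) ∧
      ringKrullDim (ConsecutiveMinors.C k m n) = ((m * n - n + (m - 1) : ℕ) : WithBot ℕ∞) ∧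
      IsReduced (ConsecutiveMinors.C k m n)) ∧
    (∀ (𝒪 : Type u) [CommRing 𝒪] [IsDomain 𝒪] [IsDiscreteValuationRing 𝒪],
      RingTheory.Sequence.IsRegular (ConsecutiveMinors.P 𝒪 m n)
        (List.ofFn (ConsecutiveMinors.f 𝒪 m n)) ∧
      ConsecutiveMinors.IsCompleteIntersection (ConsecutiveMinors.C 𝒪 m n) ∧
      ringKrullDim (ConsecutiveMinors.C 𝒪 m n) =
        ((m * n - n + (m - 1) + 1 : ℕ) : WithBot ℕ∞) ∧
      IsReduced (ConsecutiveMinors.C 𝒪 m n)) := by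
  have h0 : 0 < m := by omega
  refine ⟨fun k _ => ⟨ConsecutiveMinors.isRegular_f h0,
    ConsecutiveMinors.isCompleteIntersection_C h0, ?_, ConsecutiveMinors.isReduced_C h0⟩,
    fun 𝒪 _ _ _ => ⟨ConsecutiveMinors.isRegular_f h0,
    ConsecutiveMinors.isCompleteIntersection_C h0, ?_, ConsecutiveMinors.isReduced_C h0⟩⟩
  · exact ConsecutiveMinors.ringKrullDim_C (d := 0) h0 hmn ⊥
      (by simp) (by simp)
  · have h1 := IsPrincipalIdealRing.ringKrullDim_eq_one 𝒪
      (IsDiscreteValuationRing.not_isField 𝒪)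
    exact ConsecutiveMinors.ringKrullDim_C (d := 1) h0 hmn (IsLocalRing.maximalIdeal 𝒪)
      (IsPrincipalIdealRing.height_eq_one_of_isMaximal _ (IsDiscreteValuationRing.not_isField 𝒪))
      h1
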